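/- A digraph $D$ has finitely many vertices, at most one arc $xy$ for each ordered pair of distinct vertices, and no loops. It is semicomplete if any two distinct vertices are joined by at least one arc. Its minimum semi-degree $\delta^0(D)$ is the smaller of its minimum out-degree and its minimum in-degree. Let $k\ge 2$ be an integer and let $D$ be a semicomplete digraph of order $n\ge (9k)^5$ with $\delta^0(D)\ge\lceil (n+k-1)/2\rceil$. Then for every vertex $s$ of $D$ and every set $T=\{t_1,\dots,t_k\}$ of $k$ distinct vertices of $D$ with $s\notin T$, there are directed paths $P_1,\dots,P_k$ in $D$ such that $P_i$ is a path from $s$ to $t_i$ for each $i$, $V(P_i)\cap V(P_j)=\{s\}$ for all $i\ne j$, and $\bigcup_{i=1}^k V(P_i)=V(D)$ (that is, $D$ has a one-to-many $k$-disjoint directed path cover for $S=\{s\}$ and $T$). -/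

import Mathlib

namespace Digraph

variable {V : Type*}

/-- At least one arc joins any two distinct vertices. -/
def IsSemicomplete (D : Digraph V) : Prop :=
  ∀ x y : V, x ≠ y → D.Adj x y ∨ D.Adj y x

/-- Out-neighbourhood of `x`; `x` itself is excluded, so a loop never counts. -/
def outNbrs (D : Digraph V) (x : V) : Set V := {y | y ≠ x ∧ D.Adj x y}

/-- In-neighbourhood of `x`; `x` itself is excluded, so a loop never counts. -/
def inNbrs (D : Digraph V) (x : V) : Set V := {y | y ≠ x ∧ D.Adj y x}

/-- Out-degree (for a finite vertex set). -/
noncomputable def outDeg (D : Digraph V) (x : V) : ℕ := (D.outNbrs x).ncard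

/-- In-degree (for a finite vertex set). -/
noncomputable def inDeg (D : Digraph V) (x : V) : ℕ := (D.inNbrs x).ncard

/-- Minimum out-degree (for a nonempty vertex set). -/
noncomputable def minOutDeg (D : Digraph V) : ℕ := ⨅ x, D.outDeg x

/-- Minimum in-degree (for a nonempty vertex set). -/
noncomputable def minInDeg (D : Digraph V) : ℕ := ⨅ x, D.inDeg x

/-- Minimum semi-degree. -/
noncomputable def minSemiDeg (D : Digraph V) : ℕ := min D.minOutDeg D.minInDeg

/-- The list `P` is the vertex sequence of a directed path of `D` from `x` to `y`. -/
structure IsDipath (D : Digraph V) (x y : V) (P : List V) : Prop where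
  isChain : P.IsChain D.Adj
  nodup : P.Nodup
  head : P.head? = some x
  last : P.getLast? = some y

/-- The paths `P i`, from `s` to `t i`, form a one-to-many `k`-disjoint directed path cover. -/
structure IsOneToManyDDPC (D : Digraph V) {k : ℕ} (s : V) (t : Fin k → V)
    (P : Fin k → List V) : Prop where
  isDipath : ∀ i, D.IsDipath s (t i) (P i)
  inter : ∀ i j, i ≠ j → {v | v ∈ P i} ∩ {v | v ∈ P j} = {s}
  cover : (⋃ i, {v | v ∈ P i}) = Set.univ

end Digraph

/-! On `V \ {s}`, let every vertex of `T` trade its out-arcs for those of `s` (`CutArc`). A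
Hamiltonian dicycle of this modified digraph, cut after each vertex of `T`, falls into segments that
cover `V \ {s}`. Each segment ends in `T` and begins with an out-neighbour of `s`, so prefixing `s`
gives the required paths (`exists_segments`).

The dicycle comes from Meyniel's theorem: a strong digraph of order m in which every two nonadjacent
vertices have degree sum at least 2m - 1 is Hamiltonian (`exists_hamiltonian_dicycle`). It is proved
by the ear and multi-insertion argument of Bondy and Thomassen. Loops are added at all vertices,
each counting 2, so the bound becomes 2m + 3. Its hypotheses follow from 2δ ≥ n + k - 1 by counting
(`cutRel_exists_leaving`, `cutRel_totalDeg`). -/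

/-- A cyclic sequence of distinct vertices of a relation, given as a list. -/
structure IsDicycle {W : Type*} (R : W → W → Prop) (l : List W) : Prop where
  isChain : l.IsChain R
  nodup : l.Nodup
  close : ∀ x ∈ l.getLast?, ∀ y ∈ l.head?, R x y

/-- The dicycle `B ++ A` has an ear with interior `P` from the last to the first vertex of `B`. -/
structure IsEar {W : Type*} (R : W → W → Prop) (A B P : List W) : Prop where
  isDicycle : IsDicycle R (B ++ A)
  chain_ear : P.IsChain R
  nodup_ear : P.Nodup
  disj : ∀ x ∈ P, x ∉ B ∧ x ∉ A
  left_ne : B ≠ []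
  ear_ne : P ≠ []
  enter : ∀ x ∈ B.getLast?, ∀ y ∈ P.head?, R x y
  leave : ∀ x ∈ P.getLast?, ∀ y ∈ B.head?, R x y

/-! ### Inserting vertices into a path. -/

section Insertion

variable {W : Type*} {R : W → W → Prop}

theorem exists_split_of_not_isChain {S : W → W → Prop} {l : List W} (h : ¬ l.IsChain S) :
    ∃ l₁ b c l₂, l = l₁ ++ b :: c :: l₂ ∧ ¬ S b c := by
  induction l with
  | nil => simp at h
  | cons a l ih =>
    cases l with
    | nil => simp at h
    | cons a' l =>
      by_cases ha : S a a'
      · have : ¬ (a' :: l).IsChain S := fun h' => h (by simp [ha, h'])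
        obtain ⟨l₁, b, c, l₂, e, hS⟩ := ih this
        exact ⟨a :: l₁, b, c, l₂, by simp [e], hS⟩
      · exact ⟨[], a, a', l, rfl, ha⟩

open Classical in
/-- A vertex with many arcs to and from a list fits between two consecutive entries. -/
theorem sum_arcs_le_of_not_insertable (x : W) (l : List W)
    (h : l.IsChain (fun p q => ¬ (R p x ∧ R x q))) :
    (l.map fun w => (if R x w then 1 else 0) + (if R w x then 1 else 0)).sum ≤ l.length + 1 := by
  -- The extra term records whether `x` sends an arc to the first entry, which is what the induction
  -- must carry.
  suffices H : ∀ (b : W) (l : List W), (b :: l).IsChain (fun p q => ¬ (R p x ∧ R x q)) →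
      ((b :: l).map fun w => (if R x w then 1 else 0) + (if R w x then 1 else 0)).sum
        ≤ (b :: l).length + (if R x b then 1 else 0) by
    cases l with
    | nil => simp
    | cons b l => exact (H b l h).trans (by split_ifs <;> simp)
  intro b l
  induction l generalizing b with
  | nil => intro _; simp only [List.map_cons, List.map_nil, List.sum_cons, List.sum_nil,
      List.length_cons, List.length_nil]; split_ifs <;> simp
  | cons c l ih =>
    intro h
    rw [List.isChain_cons_cons] at h
    have := ih c h.2
    rw [List.map_cons, List.sum_cons, List.length_cons]
    have h1 := h.1
    by_cases hb : R b x <;> by_cases hc : R x c <;> simp_all <;> omega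

theorem exists_last_split {p : W → Prop} {l : List W} (h : ∃ x ∈ l, p x) :
    ∃ l₁ d l₂, l = l₁ ++ d :: l₂ ∧ p d ∧ ∀ x ∈ l₂, ¬ p x := by
  induction l with
  | nil => simp at h
  | cons y l ih =>
    by_cases hl : ∃ z ∈ l, p z
    · obtain ⟨l₁, d, l₂, e, h1⟩ := ih hl
      exact ⟨y :: l₁, d, l₂, by simp [e], h1⟩
    · obtain ⟨x, hx, hpx⟩ := h
      rcases List.mem_cons.mp hx with rfl | hx
      · exact ⟨[], x, l, rfl, hpx, fun z hz hpz => hl ⟨z, hz, hpz⟩⟩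
      · exact absurd ⟨x, hx, hpx⟩ hl

/-- Multi-insertion: if each vertex of a path `A` fits between consecutive vertices of a path `B`,
then all of `A` can be inserted into `B`. -/
theorem exists_multi_insertion (A B : List W) (hA : A.IsChain R) (hB : B.IsChain R)
    (h : ∀ x ∈ A, ¬ B.IsChain (fun p q => ¬ (R p x ∧ R x q))) :
    ∃ L : List W, L.IsChain R ∧ L.Perm (B ++ A) ∧ L.head? = B.head? ∧
      L.getLast? = B.getLast? := by
  induction hn : A.length using Nat.strong_induction_on generalizing A B with
  | _ n ih =>
  cases A with
  | nil => exact ⟨B, hB, by simp, rfl, rfl⟩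
  | cons v A =>
    obtain ⟨B₁, b, c, B₂, rfl, hbc⟩ := exists_split_of_not_isChain (h v (by simp))
    obtain ⟨hbv, hvc⟩ := not_not.mp hbc
    -- The whole block from `v` to `d` goes between `b` and `c`. Vertices of `A₂` send no arc to
    -- `c`, so the slot this destroys was not one of theirs, and they remain insertable.
    obtain ⟨A₁, d, A₂, e, hdc, hA₂⟩ := exists_last_split (p := fun x => R x c)
      ⟨v, List.mem_cons_self (l := A), hvc⟩
    have hhead : ∀ y ∈ (A₁ ++ [d]).head?, R b y := by
      have : (A₁ ++ [d]).head? = some v := by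
        cases A₁ <;> simp_all
      simp [this, hbv]
    rw [e] at hA h hn
    obtain ⟨L, h1, h2, h3, h4⟩ := ih A₂.length (by simp at hn; omega) A₂
      (B₁ ++ [b] ++ (A₁ ++ [d]) ++ c :: B₂)
      (by simp_all [List.isChain_append, List.isChain_cons]) (by
        have hlast : (b :: (A₁ ++ [d])).getLast? = some d := by
          rw [← List.cons_append, List.getLast?_concat]
        simp only [List.isChain_append, List.isChain_cons] at hA hB hhead ⊢
        simp_all)
      (by
        intro x hx hch
        refine h x (by simp [hx]) ?_
        have := hA₂ x hx
        simp only [List.isChain_append, List.isChain_cons] at hch ⊢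
        simp_all) rfl
    refine ⟨L, h1, h2.trans ?_, ?_, ?_⟩
    · rw [e]
      simp only [List.append_assoc, List.cons_append, List.nil_append]
      refine List.Perm.append_left _ (List.Perm.cons _ ?_)
      classical
      rw [List.perm_iff_count]
      intro a
      simp only [List.count_append, List.count_cons]
      omega
    · rw [h3]; cases B₁ <;> simp
    · rw [h4]; simp [List.getLast?_append, List.getLast?_cons]

end Insertion

/-! ### Meyniel's theorem. -/

section Meyniel

variable {W : Type*} {R : W → W → Prop}

/-- If every proper nonempty set can be left, then some path leaves a given set and returns to it. -/
theorem exists_ear_path (hstr : ∀ S : Set W, S.Nonempty → S ≠ Set.univ → ∃ x ∈ S, ∃ y ∉ S, R x y)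
    (C : Set W) (hC : C.Nonempty) (hC' : C ≠ Set.univ) :
    ∃ c ∈ C, ∃ c' ∈ C, ∃ P : List W, P ≠ [] ∧ P.IsChain R ∧ P.Nodup ∧ (∀ x ∈ P, x ∉ C) ∧
      (∀ x ∈ P.head?, R c x) ∧ (∀ x ∈ P.getLast?, R x c') := by
  obtain ⟨c, hc, w, hw, hcw⟩ := hstr C hC hC'
  -- `S` is what can be reached from `w` off `C`. An arc leaving `S` must end in `C`, since
  -- otherwise its end could be reached too.
  set S : Set W := {v | ∃ P : List W, P.IsChain R ∧ P.Nodup ∧ (∀ x ∈ P, x ∉ C) ∧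
    P.head? = some w ∧ P.getLast? = some v} with hS
  have hSC : ∀ v ∈ S, v ∉ C := by
    rintro v ⟨P, -, -, h, -, hl⟩
    exact h v (List.mem_of_getLast? hl)
  obtain ⟨v, ⟨P, h1, h2, h3, h4, h5⟩, v', hv', hvv'⟩ := hstr S ⟨w, [w], by simp [hw]⟩
    (fun h => hSC c (h ▸ Set.mem_univ c) hc)
  have hP : P ≠ [] := by rintro rfl; simp at h4
  by_cases hvC : v' ∈ C
  · exact ⟨c, hc, v', hvC, P, hP, h1, h2, h3, by simpa [h4] using hcw, by simpa [h5] using hvv'⟩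
  · refine absurd ?_ hv'
    by_cases hvP : v' ∈ P
    · obtain ⟨P₁, P₂, rfl⟩ := List.append_of_mem hvP
      refine ⟨P₁ ++ [v'], ?_, ?_, ?_, ?_, by simp⟩
      · simp only [List.isChain_append, List.isChain_cons] at h1 ⊢
        simp_all
      · rw [List.nodup_append] at h2 ⊢; simp_all
      · intro x hx; apply h3; simp at hx ⊢; tauto
      · rw [← h4]; cases P₁ <;> simp
    · refine ⟨P ++ [v'], ?_, ?_, ?_, ?_, by simp⟩
      · rw [List.isChain_append]; simp_all
      · rw [List.nodup_append]; simp_all; rintro a ha rfl; exact hvP ha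
      · intro x hx; simp at hx; rcases hx with hx | rfl; exacts [h3 x hx, hvC]
      · rw [← h4]; cases P <;> simp_all

theorem IsDicycle.rotate {X Y : List W} (h : IsDicycle R (X ++ Y)) : IsDicycle R (Y ++ X) := by
  obtain ⟨h1, h2, h3⟩ := h
  refine ⟨?_, by simpa using (List.perm_append_comm.nodup_iff).mp h2, ?_⟩
  · rw [List.isChain_append] at h1 ⊢
    rcases X.eq_nil_or_concat with rfl | ⟨X, x, rfl⟩
    · simp_all
    cases Y with
    | nil => simp_all
    | cons y Y =>
      refine ⟨h1.2.1, h1.1, fun a ha b hb => h3 a ?_ b ?_⟩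
      · simpa [List.getLast?_append] using ha
      · cases X <;> simp_all
  · rw [List.isChain_append] at h1
    rcases X.eq_nil_or_concat with rfl | ⟨X, x, rfl⟩
    · simp_all
    cases Y with
    | nil => simpa using h3
    | cons y Y =>
      have hlast : (y :: (Y ++ (X ++ [x]))).getLast? = some x := by
        rw [← List.append_assoc, ← List.cons_append, List.getLast?_concat]
      simpa [hlast] using h1.2.2

/-- A path and an ear from its last to its first vertex form a dicycle. -/
theorem isDicycle_append_ear {L P : List W} (hL : L.IsChain R) (hP : P.IsChain R)
    (hnd : (L ++ P).Nodup) (hL0 : L ≠ []) (hP0 : P ≠ [])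
    (enter : ∀ x ∈ L.getLast?, ∀ y ∈ P.head?, R x y)
    (leave : ∀ x ∈ P.getLast?, ∀ y ∈ L.head?, R x y) : IsDicycle R (L ++ P) := by
  refine ⟨List.isChain_append.mpr ⟨hL, hP, enter⟩, hnd, ?_⟩
  rw [List.getLast?_append_of_ne_nil _ hP0, List.head?_append_of_ne_nil _ hL0]
  exact leave

/-- After rotation `B` runs along the cycle from the ear's end to its start, and `A` is the stretch
the ear bypasses. Both ends may coincide, making `B` a single vertex. -/
theorem exists_isEar (hstr : ∀ S : Set W, S.Nonempty → S ≠ Set.univ → ∃ x ∈ S, ∃ y ∉ S, R x y)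
    {l : List W} (hl : IsDicycle R l) (hl0 : l ≠ []) (hcov : ∃ v, v ∉ l) :
    ∃ A B P, IsEar R A B P ∧ (B ++ A).length = l.length := by
  obtain ⟨v, hv⟩ := hcov
  obtain ⟨c, hc, c', hc', P, hP, h1, h2, h3, h4, h5⟩ := exists_ear_path hstr {v | v ∈ l}
    (List.exists_mem_of_ne_nil l hl0) (fun h => hv (h.symm.subset (Set.mem_univ v)))
  obtain ⟨X, Y, rfl⟩ := List.append_of_mem (show c' ∈ l from hc')
  have hrot := hl.rotate
  have hc2 : c ∈ (c' :: Y) ++ X := by simp at hc ⊢; tauto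
  obtain ⟨B, A, e⟩ := List.append_of_mem hc2
  rw [e] at hrot
  have hmem : ∀ x, x ∈ X ++ c' :: Y ↔ x ∈ B ++ c :: A := by
    intro x; rw [← e]; simp; tauto
  have hhd : (B ++ [c]).head? = some c' := by
    have := congrArg List.head? e
    cases B <;> simp_all
  refine ⟨A, B ++ [c], P, ⟨by simpa using hrot, h1, h2, ?_, by simp, hP, by simpa using h4, ?_⟩, ?_⟩
  · intro x hx
    have := h3 x hx
    rw [Set.mem_ofPred_eq, hmem] at this
    simp at this ⊢; tauto
  · rw [hhd]; simpa using h5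
  · have := congrArg List.length e
    simp at this ⊢; omega

open Classical in
/-- Total degree in a reflexive relation; the loop contributes `2`. -/
noncomputable def totalDeg [Fintype W] (R : W → W → Prop) (x : W) : ℕ :=
  (Finset.univ.filter (R x ·)).card + (Finset.univ.filter (R · x)).card

/-- Any such connection between the ear and `x` would reroute the ear to end or start at `x`,
bypassing only a proper part of `A`. -/
theorem IsEar.not_adj_of_minimal {A B P : List W} (h : IsEar R A B P)
    (hmin : ∀ A' B' P', IsEar R A' B' P' → (B' ++ A').length = (B ++ A).length →
      A.length ≤ A'.length) {x y : W} (hx : x ∈ A) (hy : y ∈ P) :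
    ∀ w, w ∉ A → w ∉ B → ¬ (R y w ∧ R w x) ∧ ¬ (R x w ∧ R w y) := by
  obtain ⟨A₁, A₂, rfl⟩ := List.append_of_mem hx
  obtain ⟨hcyc, h1, h2, h3, h4, h5, h6, h7⟩ := h
  have hfwd : ∀ Q : List W, Q ≠ [] → Q.IsChain R → Q.Nodup → (∀ z ∈ Q, z ∉ B ∧ z ∉ A₁ ++ x :: A₂) →
      (∀ a ∈ B.getLast?, ∀ b ∈ Q.head?, R a b) → (∀ a ∈ Q.getLast?, R a x) → False := by
    intro Q q1 q2 q3 q4 q5 q6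
    have := hmin A₁ ((x :: A₂) ++ B) Q ⟨?_, q2, q3, ?_, by simp, q1, ?_, ?_⟩ ?_
    · simp at this
    · have : IsDicycle R ((B ++ A₁) ++ x :: A₂) := by simpa using hcyc
      simpa using this.rotate
    · intro z hz; have := q4 z hz; simp at this ⊢; tauto
    · rw [List.getLast?_append_of_ne_nil _ h4]; exact q5
    · simpa using q6
    · simp; omega
  have hbwd : ∀ Q : List W, Q ≠ [] → Q.IsChain R → Q.Nodup → (∀ z ∈ Q, z ∉ B ∧ z ∉ A₁ ++ x :: A₂) →
      (∀ a ∈ Q.getLast?, ∀ b ∈ B.head?, R a b) → (∀ a ∈ Q.head?, R x a) → False := by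
    intro Q q1 q2 q3 q4 q5 q6
    have := hmin A₂ (B ++ (A₁ ++ [x])) Q ⟨?_, q2, q3, ?_, by simp, q1, ?_, ?_⟩ ?_
    · simp at this; omega
    · simpa using hcyc
    · intro z hz; have := q4 z hz; simp at this ⊢; tauto
    · rw [← List.append_assoc, List.getLast?_concat]; simpa using q6
    · rw [List.head?_append_of_ne_nil _ h4]; exact q5
    · simp
  have hP : ∀ z ∈ P, ¬ R z x ∧ ¬ R x z := by
    intro z hz
    obtain ⟨Q₁, Q₂, rfl⟩ := List.append_of_mem hz
    refine ⟨fun hzx => hfwd (Q₁ ++ [z]) (by simp) ?_ ?_ ?_ ?_ (by simpa using hzx),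
      fun hxz => hbwd (z :: Q₂) (by simp) ?_ ?_ ?_ ?_ (by simpa using hxz)⟩
    · exact h1.prefix (by simp)
    · exact h2.sublist (by simp)
    · intro a ha; apply h3; simp at ha ⊢; tauto
    · cases Q₁ <;> simpa using h6
    · exact h1.suffix (by simp)
    · exact h2.sublist (by simp)
    · intro a ha; apply h3; simp at ha ⊢; tauto
    · simpa [List.getLast?_append, List.getLast?_cons] using h7
  intro w hwA hwB
  by_cases hwP : w ∈ P
  · exact ⟨fun h => (hP w hwP).1 h.2, fun h => (hP w hwP).2 h.1⟩
  obtain ⟨P₁, P₂, rfl⟩ := List.append_of_mem hy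
  refine ⟨fun hyx => hfwd ((P₁ ++ [y]) ++ [w]) (by simp) ?_ ?_ ?_ ?_ (by simpa using hyx.2),
    fun hxy => hbwd (w :: y :: P₂) (by simp) ?_ ?_ ?_ ?_ (by simpa using hxy.1)⟩
  · refine List.isChain_append.mpr ⟨h1.prefix (by simp), by simp, ?_⟩
    simpa using hyx.1
  · refine List.nodup_append.mpr ⟨h2.sublist (by simp), by simp, ?_⟩
    simp at hwP ⊢; grind
  · intro a ha
    by_cases haw : a = w
    · subst haw; exact ⟨hwB, hwA⟩
    · apply h3; simp at ha ⊢; tauto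
  · cases P₁ <;> simpa using h6
  · exact List.isChain_cons_cons.mpr ⟨hxy.2, h1.suffix (by simp)⟩
  · refine List.nodup_cons.mpr ⟨fun hw => hwP (by simp at hw ⊢; tauto), h2.sublist (by simp)⟩
  · intro a ha
    by_cases haw : a = w
    · subst haw; exact ⟨hwB, hwA⟩
    · apply h3; simp at ha ⊢; tauto
  · simpa [List.getLast?_append, List.getLast?_cons] using h7

open Classical in
theorem indicator_sum_le_two (a b c d : Prop) (h₁ : ¬ (a ∧ b)) (h₂ : ¬ (c ∧ d)) :
    ((if c then 1 else 0) + (if b then 1 else 0)) +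
      ((if a then 1 else 0) + (if d then 1 else 0)) ≤ 2 := by
  by_cases a <;> by_cases b <;> by_cases c <;> by_cases d <;> simp_all

-- Suppose `l` is longest and choose an ear bypassing as few vertices as possible. Some `x` in `A`
-- does not fit into `B`, or else inserting all of `A` and closing up with `P` is longer. No `y` in
-- `P` fits into `B` either. So `x` and `y` each have at most |B| + 1 arcs with `B`, and by
-- minimality jointly at most 2 with each vertex outside it. The total 2m + 2 is too small.
open Classical in
theorem exists_longer_dicycle [Fintype W] (hrefl : ∀ x, R x x)
    (hstr : ∀ S : Set W, S.Nonempty → S ≠ Set.univ → ∃ x ∈ S, ∃ y ∉ S, R x y)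
    (hdeg : ∀ x y, ¬ R x y → ¬ R y x → 2 * Fintype.card W + 3 ≤ totalDeg R x + totalDeg R y)
    {l : List W} (hl : IsDicycle R l) (hl0 : l ≠ []) (hcov : ∃ v, v ∉ l) :
    ∃ l', IsDicycle R l' ∧ l.length < l'.length := by
  by_contra! hmax
  obtain ⟨A, B, P, h, hlen, hmin⟩ : ∃ A B P, IsEar R A B P ∧ (B ++ A).length = l.length ∧
      ∀ A' B' P', IsEar R A' B' P' → (B' ++ A').length = (B ++ A).length →
        A.length ≤ A'.length := by
    have hex : ∃ n A B P, IsEar R A B P ∧ (B ++ A).length = l.length ∧ A.length = n := by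
      obtain ⟨A, B, P, h, e⟩ := exists_isEar hstr hl hl0 hcov
      exact ⟨_, A, B, P, h, e, rfl⟩
    obtain ⟨A, B, P, h, e, hn⟩ := Nat.find_spec hex
    refine ⟨A, B, P, h, e, fun A' B' P' h' e' => ?_⟩
    rw [hn]
    exact Nat.find_min' hex ⟨A', B', P', h', e'.trans e, rfl⟩
  obtain ⟨hcyc, h1, h2, h3, h4, h5, h6, h7⟩ := id h
  have hBA := List.isChain_append.mp hcyc.isChain
  obtain ⟨x, hx, hxB⟩ : ∃ x ∈ A, B.IsChain (fun p q => ¬ (R p x ∧ R x q)) := by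
    by_contra hcon
    have hins : ∀ x ∈ A, ¬ B.IsChain (fun p q => ¬ (R p x ∧ R x q)) :=
      fun x hx hB => hcon ⟨x, hx, hB⟩
    obtain ⟨L, l1, l2, l3, l4⟩ := exists_multi_insertion A B hBA.2.1 hBA.1 hins
    have hP : 0 < P.length := List.length_pos_of_ne_nil h5
    have := hmax _ (isDicycle_append_ear l1 h1 ?_ ?_ h5 (by rwa [l4]) (by rwa [l3]))
    · rw [List.length_append, l2.length_eq] at this; omega
    · rw [List.nodup_append]
      refine ⟨l2.nodup_iff.mpr hcyc.nodup, h2, ?_⟩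
      rintro a ha b hb rfl
      have := h3 a hb
      rw [l2.mem_iff] at ha
      simp at ha; tauto
    · rintro rfl; simp at l2; exact h4 l2.1
  obtain ⟨y, hy⟩ := List.exists_mem_of_ne_nil P h5
  have hyB : B.IsChain (fun p q => ¬ (R p y ∧ R y q)) := by
    by_contra hins
    obtain ⟨B₁, b, c, B₂, rfl, hbc⟩ := exists_split_of_not_isChain hins
    obtain ⟨hb, hc⟩ := not_not.mp hbc
    have hyd := h3 y hy
    have hnd := hcyc.nodup
    have := hmax (B₁ ++ b :: y :: c :: B₂ ++ A) ⟨?_, ?_, ?_⟩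
    · rw [← hlen] at this; simp at this
    · have := hcyc.isChain
      simp only [List.append_assoc, List.cons_append, List.isChain_append,
        List.isChain_cons_cons] at this ⊢
      simp_all
    · have : (B₁ ++ b :: y :: c :: B₂ ++ A).Perm (y :: (B₁ ++ b :: c :: B₂ ++ A)) := by
        rw [List.perm_iff_count]
        intro a
        simp only [List.count_append, List.count_cons]
        omega
      rw [this.nodup_iff, List.nodup_cons]
      exact ⟨by rw [List.mem_append]; tauto, hnd⟩
    · have := hcyc.close
      have e1 : (B₁ ++ b :: y :: c :: B₂ ++ A).head? = (B₁ ++ b :: c :: B₂ ++ A).head? := by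
        cases B₁ <;> simp
      have e2 : (B₁ ++ b :: y :: c :: B₂ ++ A).getLast? = (B₁ ++ b :: c :: B₂ ++ A).getLast? := by
        simp [List.getLast?_append, List.getLast?_cons]
      rwa [e1, e2]
  have hout := fun x (hx : x ∈ A) => h.not_adj_of_minimal hmin hx hy
  have hyA : ∀ z ∈ A, ¬ R y z ∧ ¬ R z y := by
    intro z hz
    -- Using `y` itself as the middle vertex, its loop turns the two-step statement into
    -- nonadjacency.
    have := hout z hz y (h3 y hy).2 (h3 y hy).1
    exact ⟨fun hh => this.1 ⟨hrefl y, hh⟩, fun hh => this.2 ⟨hh, hrefl y⟩⟩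
  have hd := hdeg x y (hyA x hx).2 (hyA x hx).1
  have hBnd : B.Nodup := (List.nodup_append.mp hcyc.nodup).1
  set e : W → W → ℕ := fun x w => (if R x w then 1 else 0) + (if R w x then 1 else 0) with he
  have hsum : ∀ x, totalDeg R x = ∑ w ∈ B.toFinset, e x w + ∑ w ∈ B.toFinsetᶜ, e x w := by
    intro x
    rw [Finset.sum_add_sum_compl]
    simp only [totalDeg, he, Finset.card_filter, Finset.sum_add_distrib]
  have hle : ∀ x, B.IsChain (fun p q => ¬ (R p x ∧ R x q)) →
      ∑ w ∈ B.toFinset, e x w ≤ B.length + 1 := by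
    intro x hx
    rw [List.sum_toFinset _ hBnd]
    exact sum_arcs_le_of_not_insertable x B hx
  have hcompl : ∑ w ∈ B.toFinsetᶜ, e x w + ∑ w ∈ B.toFinsetᶜ, e y w ≤ B.toFinsetᶜ.card * 2 := by
    rw [← Finset.sum_add_distrib]
    refine Finset.sum_le_card_nsmul _ _ 2 fun w hw => ?_
    have hwB : w ∉ B := by simpa using hw
    by_cases hwA : w ∈ A
    · exact indicator_sum_le_two _ _ _ _ (fun hh => (hyA w hwA).1 hh.1) (fun hh => (hyA w hwA).2 hh.2)
    · exact indicator_sum_le_two _ _ _ _ (hout x hx w hwA hwB).1 (hout x hx w hwA hwB).2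
  have hcard := Finset.card_add_card_compl B.toFinset
  rw [List.toFinset_card_of_nodup hBnd] at hcard
  have := hle x hxB
  have := hle y hyB
  rw [hsum, hsum] at hd
  omega

/-- **Meyniel's theorem**, for a reflexive relation that leaves every proper nonempty set. -/
theorem exists_hamiltonian_dicycle [Fintype W] [Nonempty W] (hrefl : ∀ x, R x x)
    (hstr : ∀ S : Set W, S.Nonempty → S ≠ Set.univ → ∃ x ∈ S, ∃ y ∉ S, R x y)
    (hdeg : ∀ x y, ¬ R x y → ¬ R y x → 2 * Fintype.card W + 3 ≤ totalDeg R x + totalDeg R y) :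
    ∃ l, IsDicycle R l ∧ ∀ v, v ∈ l := by
  suffices H : ∀ n, ∀ l, IsDicycle R l → l ≠ [] → Fintype.card W - l.length = n →
      ∃ l, IsDicycle R l ∧ ∀ v, v ∈ l by
    obtain ⟨v⟩ := ‹Nonempty W›
    -- Thanks to the loop, a single vertex is a dicycle to start from.
    exact H _ [v] ⟨by simp, by simp, by simp [hrefl]⟩ (by simp) rfl
  intro n
  induction n using Nat.strong_induction_on with
  | _ n ih =>
  intro l hl hl0 hn
  by_cases hcov : ∃ v, v ∉ l
  · obtain ⟨l', hl', hlt⟩ := exists_longer_dicycle hrefl hstr hdeg hl hl0 hcov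
    have := hl'.nodup.length_le_card
    exact ih _ (by omega) l' hl' (by rintro rfl; simp at hlt) rfl
  · push Not at hcov
    exact ⟨l, hl, hcov⟩

end Meyniel

namespace Digraph

variable {V : Type*}

/-! ### Cutting a walk of the modified digraph into paths from `s`. -/

section Segments

open Classical in
/-- An arc leaving a vertex of `T` is replaced by the corresponding arc leaving `s`. -/
def CutArc (D : Digraph V) (s : V) (T : Set V) (x y : V) : Prop :=
  D.Adj (if x ∈ T then s else x) y

variable {D : Digraph V} {s : V} {T : Set V}

theorem CutArc.adj_of_mem {x y : V} (h : D.CutArc s T x y) (hx : x ∈ T) : D.Adj s y := by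
  simpa [CutArc, hx] using h

theorem CutArc.adj_of_notMem {x y : V} (h : D.CutArc s T x y) (hx : x ∉ T) : D.Adj x y := by
  simpa [CutArc, hx] using h

theorem isChain_adj_of_cutArc {t : V} {l : List V} (hl : ∀ x ∈ l, x ∉ T)
    (h : (l ++ [t]).IsChain (D.CutArc s T)) : (l ++ [t]).IsChain D.Adj := by
  induction l with
  | nil => simp
  | cons x l ih =>
    rw [List.cons_append, List.isChain_cons] at h ⊢
    exact ⟨fun y hy => (h.1 y hy).adj_of_notMem (hl x (by simp)),
      ih (fun y hy => hl y (by simp [hy])) h.2⟩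

theorem exists_first_split {p : V → Prop} {l : List V} (h : ∃ x ∈ l, p x) :
    ∃ l₁ d l₂, l = l₁ ++ d :: l₂ ∧ p d ∧ ∀ x ∈ l₁, ¬ p x := by
  obtain ⟨l₁, d, l₂, e, h1, h2⟩ := exists_last_split (p := p) (l := l.reverse) (by simpa using h)
  exact ⟨l₂.reverse, d, l₁.reverse, by simpa using congrArg List.reverse e, h1, by simpa using h2⟩

/-- Cutting a walk of the modified digraph after each vertex of `T` gives paths starting at `s`. -/
theorem exists_segments (a : V) (l : List V) (ha : a ∈ T) (hnd : l.Nodup)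
    (hch : (a :: l).IsChain (D.CutArc s T)) (hlast : ∀ x ∈ l.getLast?, x ∈ T) :
    ∃ Q : V → List V, (∀ t ∈ T, t ∈ l → (s :: Q t).IsChain D.Adj ∧ (Q t).getLast? = some t ∧
        (Q t).Nodup ∧ ∀ x ∈ Q t, x ∈ l) ∧
      (∀ v ∈ l, ∃ t ∈ T, t ∈ l ∧ v ∈ Q t) ∧
      (∀ t ∈ T, t ∈ l → ∀ t' ∈ T, t' ∈ l → t ≠ t' → ∀ v ∈ Q t, v ∉ Q t') := by
  classical
  induction hn : l.length using Nat.strong_induction_on generalizing a l with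
  | _ n ih =>
  rcases l.eq_nil_or_concat with rfl | ⟨l', z, hl'⟩
  · exact ⟨fun _ => [], by simp⟩
  have hz : z ∈ T := hlast z (by simp [hl'])
  -- The segment up to the first vertex `t` of `T` has only original arcs, and its entering arc from
  -- `a` is really one from `s`. Then `t` takes over the role of `a`.
  obtain ⟨l₁, t, l₂, rfl, ht, hl₁⟩ := exists_first_split (p := (· ∈ T)) (l := l)
    ⟨z, by simp [hl'], hz⟩
  have hnd' := hnd
  rw [List.nodup_append, List.nodup_cons] at hnd'
  rw [List.isChain_cons] at hch
  obtain ⟨Q, h1, h2, h3⟩ := ih l₂.length (by simp at hn; omega) t l₂ ht hnd'.2.1.2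
    (hch.2.suffix (by simp)) (by
      intro x hx
      apply hlast
      simp only [Option.mem_def] at hx
      simp [List.getLast?_append, List.getLast?_cons, hx]) rfl
  have htl₂ : t ∉ l₂ := hnd'.2.1.1
  have hdisj : ∀ v ∈ l₁ ++ [t], v ∉ l₂ := by
    intro v hv hv2
    simp only [List.mem_append, List.mem_singleton] at hv
    rcases hv with hv | rfl
    · exact hnd'.2.2 v hv v (by simp [hv2]) rfl
    · exact htl₂ hv2
  have hmem : ∀ t' ∈ T, t' ∈ l₁ ++ t :: l₂ → t' = t ∨ (t' ≠ t ∧ t' ∈ l₂) := by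
    intro t' ht' hm
    simp only [List.mem_append, List.mem_cons] at hm
    rcases hm with hm | hm | hm
    · exact absurd ht' (hl₁ t' hm)
    · exact Or.inl hm
    · exact Or.inr ⟨fun e => htl₂ (e ▸ hm), hm⟩
  refine ⟨Function.update Q t (l₁ ++ [t]), ?_, ?_, ?_⟩
  · intro t' ht' hm
    rcases hmem t' ht' hm with rfl | ⟨hne, hm⟩
    · rw [Function.update_self]
      refine ⟨List.isChain_cons.mpr ⟨fun y hy => (hch.1 y ?_).adj_of_mem ha,
        isChain_adj_of_cutArc hl₁ (hch.2.prefix (by simp))⟩, by simp,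
        hnd.sublist (by simp), fun x hx => ?_⟩
      · cases l₁ <;> simpa using hy
      · simp at hx ⊢; tauto
    · rw [Function.update_of_ne hne]
      obtain ⟨g1, g2, g3, g4⟩ := h1 t' ht' hm
      exact ⟨g1, g2, g3, fun x hx => by simp [g4 x hx]⟩
  · intro v hv
    by_cases hv2 : v ∈ l₂
    · obtain ⟨t', ht', hm, hvt⟩ := h2 v hv2
      have hne : t' ≠ t := by rintro rfl; exact htl₂ hm
      exact ⟨t', ht', by simp [hm], by rwa [Function.update_of_ne hne]⟩
    · exact ⟨t, ht, by simp, by rw [Function.update_self]; simp at hv ⊢; tauto⟩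
  · intro t' ht' hm t'' ht'' hm' hne v hv hv'
    rcases hmem t' ht' hm with rfl | ⟨hne1, hm₁⟩ <;>
      rcases hmem t'' ht'' hm' with rfl | ⟨hne2, hm₂⟩
    · exact hne rfl
    · rw [Function.update_self] at hv
      rw [Function.update_of_ne hne2] at hv'
      exact hdisj v hv ((h1 t'' ht'' hm₂).2.2.2 v hv')
    · rw [Function.update_self] at hv'
      rw [Function.update_of_ne hne1] at hv
      exact hdisj v hv' ((h1 t' ht' hm₁).2.2.2 v hv)
    · rw [Function.update_of_ne hne1] at hv
      rw [Function.update_of_ne hne2] at hv'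
      exact h3 t' ht' hm₁ t'' ht'' hm₂ hne v hv hv'

end Segments

/-! ### Degree conditions in the modified digraph. -/

section Degrees

variable [Fintype V] (D : Digraph V) (s : V) (T : Set V)

/-- The modified digraph on `V \ {s}`, made reflexive. -/
def CutRel (x y : {v : V // v ≠ s}) : Prop := x = y ∨ D.CutArc s T x y

variable {D s T} {δ : ℕ}

open Classical in
theorem ncard_le_card_filter {p : {v : V // v ≠ s} → Prop} {A : Set V}
    (h : ∀ a ∈ A, ∃ ha : a ≠ s, p ⟨a, ha⟩) : A.ncard ≤ (Finset.univ.filter p).card := by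
  rw [← Finset.card_map (Function.Embedding.subtype _), ← Set.ncard_coe_finset]
  refine Set.ncard_le_ncard (fun a ha => ?_) (Set.toFinite _)
  obtain ⟨h1, h2⟩ := h a ha
  simpa using ⟨h1, h2⟩

open Classical in
theorem ncard_add_one_le_card_filter {p : {v : V // v ≠ s} → Prop} {A : Set V}
    {x : {v : V // v ≠ s}} (hx : p x) (hxA : x.1 ∉ A)
    (h : ∀ a ∈ A, ∃ ha : a ≠ s, p ⟨a, ha⟩) : A.ncard + 1 ≤ (Finset.univ.filter p).card := by
  rw [← Set.ncard_insert_of_notMem hxA (Set.toFinite _)]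
  refine ncard_le_card_filter fun a ha => ?_
  rcases ha with rfl | ha
  exacts [⟨x.2, hx⟩, h a ha]

-- At most one out-neighbour is lost (`x` itself if `x` is in `T`, otherwise `s`), and the loop
-- makes up for it.
open Classical in
theorem le_card_out (hout : ∀ x, δ ≤ D.outDeg x) (x : {v : V // v ≠ s}) :
    δ ≤ (Finset.univ.filter (D.CutRel s T x ·)).card := by
  by_cases hx : x.1 ∈ T
  · have h1 := Set.pred_ncard_le_ncard_sdiff_singleton (D.outNbrs s) x.1
    have h2 := ncard_add_one_le_card_filter (p := (D.CutRel s T x ·)) (x := x)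
      (A := D.outNbrs s \ {x.1}) (Or.inl rfl) (by simp)
      (fun a ha => ⟨ha.1.1, Or.inr (by simpa [CutArc, hx] using ha.1.2)⟩)
    have h3 : δ ≤ (D.outNbrs s).ncard := hout s
    omega
  · have h1 := Set.pred_ncard_le_ncard_sdiff_singleton (D.outNbrs x) s
    have h2 := ncard_add_one_le_card_filter (p := (D.CutRel s T x ·)) (x := x)
      (A := D.outNbrs x \ {s}) (Or.inl rfl) (by simp [outNbrs])
      (fun a ha => ⟨ha.2, Or.inr (by simpa [CutArc, hx] using ha.1.2)⟩)
    have h3 : δ ≤ (D.outNbrs x).ncard := hout x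
    omega

open Classical in
theorem add_one_le_card_out (hout : ∀ x, δ ≤ D.outDeg x) (x : {v : V // v ≠ s}) (hx : x.1 ∈ T)
    (hsx : ¬ D.Adj s x) : δ + 1 ≤ (Finset.univ.filter (D.CutRel s T x ·)).card := by
  have h2 := ncard_add_one_le_card_filter (p := (D.CutRel s T x ·)) (x := x)
    (A := D.outNbrs s) (Or.inl rfl) (fun h => hsx h.2)
    (fun a ha => ⟨ha.1, Or.inr (by simpa [CutArc, hx] using ha.2)⟩)
  have h3 : δ ≤ (D.outNbrs s).ncard := hout s
  omega

open Classical in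
theorem le_card_in_of_adj (hin : ∀ x, δ ≤ D.inDeg x) (x : {v : V // v ≠ s})
    (hsx : D.Adj s x) : δ ≤ (Finset.univ.filter (D.CutRel s T · x)).card := by
  have h1 := Set.pred_ncard_le_ncard_sdiff_singleton (D.inNbrs x) s
  have h2 := ncard_add_one_le_card_filter (p := (D.CutRel s T · x)) (x := x)
    (A := D.inNbrs x \ {s}) (Or.inl rfl) (by simp [inNbrs])
    (fun a ha => ⟨ha.2, Or.inr (by
      by_cases haT : a ∈ T
      · simpa [CutArc, haT] using hsx
      · simpa [CutArc, haT] using ha.1.2)⟩)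
  have h3 : δ ≤ (D.inNbrs x).ncard := hin x
  omega

-- Here `s` is not an in-neighbour to lose; only those in `T` can disappear, and the loop adds one.
open Classical in
theorem le_card_in_of_not_adj (hin : ∀ x, δ ≤ D.inDeg x) (x : {v : V // v ≠ s})
    (hsx : ¬ D.Adj s x) :
    δ + 1 ≤ (Finset.univ.filter (D.CutRel s T · x)).card + (T \ {x.1}).ncard := by
  have h1 := Set.le_ncard_sdiff (T \ {x.1}) (D.inNbrs x)
  have h2 := ncard_add_one_le_card_filter (p := (D.CutRel s T · x)) (x := x)
    (A := D.inNbrs x \ (T \ {x.1})) (Or.inl rfl) (by simp [inNbrs])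
    (fun a ha => ⟨fun e => hsx (e ▸ ha.1.2), Or.inr (by
      have haT : a ∉ T := fun haT => ha.2 ⟨haT, ha.1.1⟩
      simpa [CutArc, haT] using ha.1.2)⟩)
  have h3 : δ ≤ (D.inNbrs x).ncard := hin x
  omega

open Classical in
theorem add_one_le_card_in (hin : ∀ x, δ ≤ D.inDeg x) (hT : T.Nonempty) (x : {v : V // v ≠ s}) :
    δ + 1 ≤ (Finset.univ.filter (D.CutRel s T · x)).card + T.ncard := by
  by_cases hsx : D.Adj s x
  · have := le_card_in_of_adj (T := T) hin x hsx
    have := hT.ncard_pos (Set.toFinite T)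
    omega
  · have := le_card_in_of_not_adj (T := T) hin x hsx
    have := Set.ncard_le_ncard (Set.sdiff_subset (s := T) (t := {x.1})) (Set.toFinite _)
    omega

/-- For `x` in `S` and `y` outside, the out-set of `x` and in-set of `y` have total size at least 2δ
+ 1 - k ≥ n, more than the n - 1 vertices, so they share a vertex. One of the two arcs through it
leaves `S`. -/
theorem cutRel_exists_leaving (hout : ∀ x, δ ≤ D.outDeg x) (hin : ∀ x, δ ≤ D.inDeg x)
    (hT : T.Nonempty) (hn : Fintype.card V + T.ncard ≤ 2 * δ + 1)
    (S : Set {v : V // v ≠ s}) (hS : S.Nonempty) (hS' : S ≠ Set.univ) :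
    ∃ x ∈ S, ∃ y ∉ S, D.CutRel s T x y := by
  classical
  by_contra! hcon
  obtain ⟨x, hx⟩ := hS
  obtain ⟨y, hy⟩ := (Set.ne_univ_iff_exists_notMem S).mp hS'
  have h1 := le_card_out (T := T) hout x
  have h2 := add_one_le_card_in hin hT y
  have h3 : Disjoint (Finset.univ.filter (D.CutRel s T x ·))
      (Finset.univ.filter (D.CutRel s T · y)) := by
    rw [Finset.disjoint_left]
    intro z hz hz'
    simp only [Finset.mem_filter, Finset.mem_univ, true_and] at hz hz'
    by_cases hzS : z ∈ S
    · exact hcon z hzS y hy hz'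
    · exact hcon x hx z hzS hz
  have h4 := Finset.card_le_univ (Finset.disjUnion _ _ h3)
  rw [Finset.card_disjUnion, Fintype.card_subtype_compl, Fintype.card_subtype_eq] at h4
  have : 0 < Fintype.card V := Fintype.card_pos_iff.mpr ⟨s⟩
  omega

-- Semicompleteness forces one of two nonadjacent vertices, say `x`, into `T`; then `s` has no arc
-- to `y`. If `s` has an arc to `x`, the degree sum is at least 4δ + 1 - k ≥ 2n + k - 1; otherwise
-- it is at least 4δ + 4 - 2k ≥ 2n + 2. Both reach 2(n - 1) + 3, the former because k ≥ 2.
open Classical in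
theorem cutRel_totalDeg (hD : D.IsSemicomplete)
    (hout : ∀ x, δ ≤ D.outDeg x) (hin : ∀ x, δ ≤ D.inDeg x)
    (hT : 2 ≤ T.ncard) (hn : Fintype.card V + T.ncard ≤ 2 * δ + 1)
    (x y : {v : V // v ≠ s}) (hxy : ¬ D.CutRel s T x y) (hyx : ¬ D.CutRel s T y x) :
    2 * Fintype.card {v : V // v ≠ s} + 3 ≤
      totalDeg (D.CutRel s T) x + totalDeg (D.CutRel s T) y := by
  have hTne : T.Nonempty := Set.nonempty_of_ncard_ne_zero (by omega)
  rw [Fintype.card_subtype_compl, Fintype.card_subtype_eq]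
  have hV : 0 < Fintype.card V := Fintype.card_pos_iff.mpr ⟨s⟩
  wlog hxT : x.1 ∈ T generalizing x y
  · by_cases hyT : y.1 ∈ T
    · rw [add_comm (totalDeg _ x)]
      exact this y x hyx hxy hyT
    · have hne : x.1 ≠ y.1 := fun e => hxy (Or.inl (Subtype.ext e))
      rcases hD x y hne with h | h
      · exact absurd (Or.inr (by simpa [CutArc, hxT] using h)) hxy
      · exact absurd (Or.inr (by simpa [CutArc, hyT] using h)) hyx
  have hsy : ¬ D.Adj s y := fun h => hxy (Or.inr (by simpa [CutArc, hxT] using h))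
  have hcard := Set.ncard_sdiff_singleton_add_one hxT (Set.toFinite T)
  have hx1 := le_card_out (T := T) hout x
  have hy1 := le_card_out (T := T) hout y
  have hy2 := add_one_le_card_in hin hTne y
  unfold totalDeg
  by_cases hsx : D.Adj s x
  · have hx2 := le_card_in_of_adj (T := T) hin x hsx
    omega
  · have hx2 := le_card_in_of_not_adj (T := T) hin x hsx
    have hx3 := add_one_le_card_out hout x hxT hsx
    omega

end Degrees

/-! ### From the Hamiltonian dicycle to the path cover. -/

theorem minSemiDeg_le_outDeg (D : Digraph V) (x : V) : D.minSemiDeg ≤ D.outDeg x :=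
  (min_le_left _ _).trans (ciInf_le (OrderBot.bddBelow _) x)

theorem minSemiDeg_le_inDeg (D : Digraph V) (x : V) : D.minSemiDeg ≤ D.inDeg x :=
  (min_le_right _ _).trans (ciInf_le (OrderBot.bddBelow _) x)

/-- A Hamiltonian dicycle of the modified digraph is a closed walk at any vertex other than `s`. -/
theorem exists_closed_walk {D : Digraph V} {s a : V} {T : Set V} (has : a ≠ s)
    {l : List {v : V // v ≠ s}} (hl : IsDicycle (D.CutRel s T) l) (hcov : ∀ v, v ∈ l)
    (hcard : 2 ≤ l.length) :
    ∃ L : List V, (a :: L).IsChain (D.CutArc s T) ∧ L.Nodup ∧ L.getLast? = some a ∧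
      ∀ v, v ∈ L ↔ v ≠ s := by
  obtain ⟨X, Y, rfl⟩ := List.append_of_mem (hcov ⟨a, has⟩)
  obtain ⟨h1, h2, h3⟩ := hl.rotate
  have hne : Y ++ X ≠ [] := by
    intro h; simp at h; simp [h] at hcard
  set a' : {v : V // v ≠ s} := ⟨a, has⟩ with ha'
  have h4 : (a' :: (Y ++ X) ++ [a']).IsChain
      (fun x y : {v : V // v ≠ s} => D.CutArc s T x y) := by
    rw [List.isChain_append]
    refine ⟨?_, by simp, fun x hx y hy => ?_⟩
    -- Consecutive vertices are distinct, so no step is a loop and each is a genuine arc. At the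
    -- closing step this needs at least two vertices.
    · have h5 : (a' :: (Y ++ X)).IsChain (fun x y : {v : V // v ≠ s} => x ≠ y) :=
        List.Pairwise.isChain h2
      rw [List.isChain_iff_getElem] at h1 h5 ⊢
      exact fun i hi => (h1 i hi).resolve_left (h5 i hi)
    · have hax : x ≠ y := by
        have hx' : x ∈ Y ++ X := by
          rw [List.getLast?_cons_of_ne_nil hne] at hx
          exact List.mem_of_getLast? hx
        have hy' : y = a' := by simpa using hy.symm
        rintro rfl
        exact (List.nodup_cons.mp h2).1 (hy' ▸ hx')
      exact (h3 x hx y (by simpa using hy)).resolve_left hax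
  refine ⟨((Y ++ X) ++ [a']).map Subtype.val, ?_, ?_, by simp [ha'], ?_⟩
  · have := (List.isChain_map (R := D.CutArc s T) (Subtype.val : {v : V // v ≠ s} → V)).mpr h4
    simpa using this
  · refine List.Nodup.map Subtype.val_injective ?_
    rw [List.nodup_append_comm]
    simpa using h2
  · intro v
    constructor
    · intro hv
      obtain ⟨w, -, rfl⟩ := List.mem_map.mp hv
      exact w.2
    · intro hv
      have := hcov ⟨v, hv⟩
      refine List.mem_map.mpr ⟨⟨v, hv⟩, ?_, rfl⟩
      simp only [List.mem_append, List.mem_cons, List.not_mem_nil, or_false] at this ⊢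
      tauto

end Digraph

open Digraph in
theorem theorem1 {V : Type*} [Fintype V] (D : Digraph V) (k : ℕ) (hk : 2 ≤ k)
    (hD : D.IsSemicomplete)
    (hn : (9 * k) ^ 5 ≤ Fintype.card V)
    (hdeg : ⌈((Fintype.card V : ℚ) + (k : ℚ) - 1) / 2⌉ ≤ (D.minSemiDeg : ℤ))
    (s : V) (t : Fin k → V) (ht : Function.Injective t) (hs : ∀ i, t i ≠ s) :
    ∃ P : Fin k → List V, D.IsOneToManyDDPC s t P := by
  classical
  have hT : (Set.range t).ncard = k := by
    rw [← Set.image_univ, Set.ncard_image_of_injective _ ht, Set.ncard_univ, Nat.card_fin]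
  have hδ : Fintype.card V + (Set.range t).ncard ≤ 2 * D.minSemiDeg + 1 := by
    have h := Int.ceil_le.mp hdeg
    push_cast at h
    have : (Fintype.card V : ℚ) + k ≤ 2 * D.minSemiDeg + 1 := by linarith
    rw [hT]
    exact_mod_cast this
  have hcard : 2 ≤ Fintype.card {v : V // v ≠ s} := by
    have h := Finset.card_le_card_of_injOn (s := (Finset.univ : Finset (Fin k)))
      (t := (Finset.univ : Finset {v : V // v ≠ s})) (fun i => ⟨t i, hs i⟩) (by simp)
      (fun i _ j _ h => ht (congrArg Subtype.val h))
    simp only [Finset.card_univ, Fintype.card_fin] at h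
    omega
  let i₀ : Fin k := ⟨0, by omega⟩
  have : Nonempty {v : V // v ≠ s} := ⟨⟨t i₀, hs i₀⟩⟩
  obtain ⟨l, hl, hcov⟩ := exists_hamiltonian_dicycle (R := D.CutRel s (Set.range t))
    (fun _ => Or.inl rfl)
    (cutRel_exists_leaving D.minSemiDeg_le_outDeg D.minSemiDeg_le_inDeg ⟨_, i₀, rfl⟩ hδ)
    (cutRel_totalDeg hD D.minSemiDeg_le_outDeg D.minSemiDeg_le_inDeg (by omega) hδ)
  have hlen : 2 ≤ l.length := by
    refine hcard.trans ?_
    rw [← List.toFinset_card_of_nodup hl.nodup, ← Finset.card_univ]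
    exact Finset.card_le_card fun v _ => by simpa using hcov v
  obtain ⟨L, h1, h2, h3, h4⟩ := exists_closed_walk (hs i₀) hl hcov hlen
  obtain ⟨Q, q1, q2, q3⟩ := exists_segments (t i₀) L (Set.mem_range_self i₀) h2 h1
    (by rw [h3]; simp)
  have htL : ∀ i, t i ∈ L := fun i => (h4 _).mpr (hs i)
  refine ⟨fun i => s :: Q (t i), fun i => ?_, fun i j hij => ?_, ?_⟩
  · obtain ⟨g1, g2, g3, g4⟩ := q1 (t i) ⟨i, rfl⟩ (htL i)
    refine ⟨g1, List.nodup_cons.mpr ⟨fun h => (h4 s).mp (g4 s h) rfl, g3⟩, rfl, ?_⟩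
    rw [List.getLast?_cons, g2]
    rfl
  · ext v
    have := q3 (t i) ⟨i, rfl⟩ (htL i) (t j) ⟨j, rfl⟩ (htL j) (fun h => hij (ht h)) v
    simp only [Set.mem_inter_iff, Set.mem_ofPred_eq, List.mem_cons, Set.mem_singleton_iff]
    tauto
  · refine Set.eq_univ_of_forall fun v => Set.mem_iUnion.mpr ?_
    by_cases hv : v = s
    · exact ⟨i₀, by simp [hv]⟩
    · obtain ⟨_, ⟨i, rfl⟩, -, h⟩ := q2 v ((h4 v).mpr hv)
      exact ⟨i, by simp [h]⟩
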